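/- **Setting.** A network on at most $n$ vertices is a finite simple graph whose vertices carry distinct IDs in $\{0,\dots,n-1\}$. Computation is deterministic and proceeds in synchronous rounds: in each round every vertex sends its RAM to all its neighbors, and then updates its RAM as a function of its own ID, its RAM, and the received messages (tagged by the senders' IDs); the program may depend on $n$ and on a degree bound $\Delta$. Before some time $t_0$ the execution is arbitrary: the RAM of every vertex may be corrupted arbitrarily, and vertices and edges may appear and vanish. From time $t_0$ on the network is a fixed graph $G=(V,E)$ of maximum degree at most $\Delta$ and all rounds are faultless. An algorithm has stabilization time at most $T$ for an edge problem if, in every such execution, there is a correct solution for $G$ which both endpoints of every edge output at all times $t\ge t_0+T$. Here $\log^* n$ is the number of times $\log_2$ has to be applied, starting from $n$, to reach a number smaller than $2$. **Line-graph simulation.** A locally-iterative vertex algorithm $A$ for IDs in $\{0,\dots,N-1\}$ has a finite state set, an initial state for each ID, and an update rule by which each vertex computes its new state from its ID, its state, and the set of its neighbors' states. For $N=n^2$, the simulation of $A$ on the line graph works as follows. Each vertex holds in its RAM one register for each incident edge, with a copy of the state of the virtual vertex corresponding to that edge. In every round, the two endpoints $a<b$ of an edge reconcile their copies, the endpoint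 $b$ with the larger ID adopting the state held by $a$ (if $a$ holds none, the state held by $b$ is used, and if neither holds one, the initial state), and both of them then perform one step of $A$ for the virtual vertex $ab$, with ID $an+b$, whose neighbors are the other virtual vertices at $a$ and at $b$. **Theorem.** There are a constant $C$ and, for all integers $N,D\ge 0$, locally-iterative vertex algorithms $\mathrm{MIS}_{N,D}$ and $\mathrm{COL}_{N,D}$ for IDs in $\{0,\dots,N-1\}$, each with at most $(N+D+2)^{C}$ states, such that for all integers $n,\Delta\ge 0$, on all networks on at most $n$ vertices of maximum degree at most $\Delta$: 1. the simulation of $\mathrm{MIS}_{n^2,\max(2\Delta-2,0)}$ on the line graph is a self-stabilizing maximal matching algorithm with stabilization time at most $C\,(\Delta+\log^* n)$; 2. the simulation of $\mathrm{COL}_{n^2,\max(2\Delta-2,0)}$ on the line graph is a self-stabilizing algorithm for proper $(2\Delta-1)$-edge-coloring (with colors $0,\dots,2\Delta-2$) with stabilization time at most $C\,(\Delta+\log^* n)$. Here a set $M\subseteq E$ is a maximal matching if no two distinct edges of $M$ share an endpoint and every edge of $E\setminus M$ shares an endpoint with an edge of $M$; an edge coloring is proper if distinct edges sharing an endpoint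 have distinct colors. -/

import Mathlib

/-! ### The iterated logarithm -/

/-- `logStar n` is the number of times `log₂` has to be applied, starting from `n`, until a number
smaller than `2` is reached. -/
noncomputable def logStar (n : ℕ) : ℕ :=
  sInf {k : ℕ | (Real.logb 2)^[k] (n : ℝ) < 2}

/-! ### Maximal matchings and edge colorings of a set of edges -/

/-- Two edges are incident if they share an endpoint. -/
def Incident {V : Type*} (e e' : Sym2 V) : Prop :=
  ∃ v, v ∈ e ∧ v ∈ e'

/-- `M` is a maximal matching of the edge set `E`. -/
def IsMaximalMatching {V : Type*} (E M : Set (Sym2 V)) : Prop :=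
  M ⊆ E ∧
  (∀ e ∈ M, ∀ e' ∈ M, e ≠ e' → ¬ Incident e e') ∧
  ∀ e ∈ E, e ∉ M → ∃ e' ∈ M, Incident e e'

/-- `c` restricted to the edge set `E` is a proper edge coloring with the colors
`0, 1, …, k - 1`. -/
def IsProperEdgeColoring {V : Type*} (E : Set (Sym2 V)) (k : ℕ) (c : Sym2 V → ℕ) : Prop :=
  (∀ e ∈ E, c e < k) ∧
  ∀ e ∈ E, ∀ e' ∈ E, e ≠ e' → Incident e e' → c e ≠ c e'

/-! ### The fully dynamic self-stabilizing setting -/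

/-- A network on at most `n` vertices. A vertex is identified with its unique ID in
`{0, …, n - 1}`; the vertices that are present form the set `G.verts`. -/
abbrev Network (n : ℕ) : Type := (⊤ : SimpleGraph (Fin n)).Subgraph

/-- Every vertex of the network has at most `Δ` neighbors. -/
def Network.DegreeAtMost {n : ℕ} (G : Network n) (Δ : ℕ) : Prop :=
  ∀ v, (G.neighborSet v).ncard ≤ Δ

/-- A deterministic synchronous distributed algorithm with an output in `Out` for every edge at
each of its endpoints. The program may be chosen according to `n` and the degree bound; together
with the ID of the vertex these form the read-only memory. In every round a vertex sends its RAM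
to all its neighbors and updates its RAM. -/
structure LocalAlgorithm (n : ℕ) (Out : Type) where
  /-- the possible contents of the RAM of a vertex -/
  RAM : Type
  /-- `step v r B` is the new RAM of the vertex with ID `v` and RAM `r`; here `B u = some r'` if
  there is a neighbor with ID `u`, and the message `r'` has just been received from it, and
  `B u = none` if there is no such neighbor -/
  step : Fin n → RAM → (Fin n → Option RAM) → RAM
  /-- `edgeOutput r u` is what a vertex with RAM `r` outputs for the edge to the neighbor `u`
  (`none` if it outputs nothing) -/
  edgeOutput : RAM → Fin n → Option Out

namespace LocalAlgorithm

variable {n : ℕ} {Out : Type}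

open Classical in
/-- The RAM of `v` after one faultless round in the network `G` with RAM contents `σ`. -/
noncomputable def nextRAM (A : LocalAlgorithm n Out) (G : Network n) (σ : Fin n → A.RAM)
    (v : Fin n) : A.RAM :=
  A.step v (σ v) (fun u => if G.Adj v u then some (σ u) else none)

/-- In the execution with network `G t` and RAM contents `σ t` at time `t`, no fault and no
change of the network occurs from time `t₀` on. Up to time `t₀` everything is arbitrary:
vertices and edges may appear and vanish, and the RAM of any vertex may be corrupted. -/
def FaultFreeFrom (A : LocalAlgorithm n Out) (G : ℕ → Network n) (σ : ℕ → Fin n → A.RAM)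
    (t₀ : ℕ) : Prop :=
  ∀ t, t₀ ≤ t → G t = G t₀ ∧ ∀ v ∈ (G t₀).verts, σ (t + 1) v = A.nextRAM (G t₀) (σ t) v

/-- Both endpoints of each edge `e` of the network output `f e` for it. -/
def Outputs (A : LocalAlgorithm n Out) (G : Network n) (σ : Fin n → A.RAM)
    (f : Sym2 (Fin n) → Out) : Prop :=
  ∀ u v, G.Adj u v → A.edgeOutput (σ u) v = some (f s(u, v))

/-- On networks of maximum degree at most `Δ`, the algorithm is self-stabilizing with
stabilization time at most `T` for the edge problem `Spec` (whose instances are sets of edges):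
in every execution, at all times that are at least `T` rounds after the last fault or change of
the network, the output is one and the same correct solution for the present network. -/
def StabilizesWithin (A : LocalAlgorithm n Out) (Δ T : ℕ)
    (Spec : Set (Sym2 (Fin n)) → (Sym2 (Fin n) → Out) → Prop) : Prop :=
  ∀ (G : ℕ → Network n) (σ : ℕ → Fin n → A.RAM) (t₀ : ℕ),
    (G t₀).DegreeAtMost Δ → A.FaultFreeFrom G σ t₀ →
      ∃ f, Spec (G t₀).edgeSet f ∧ ∀ t, t₀ + T ≤ t → A.Outputs (G t₀) (σ t) f

end LocalAlgorithm

/-! ### Simulation of the line graph -/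

/-- A locally-iterative vertex algorithm for graphs whose vertices have IDs in
`{0, …, N - 1}`: in every round, the new state of a vertex is computed from its ID, its state, and
the set of the states of its neighbors. -/
structure VertexAlgorithm (N : ℕ) (Out : Type) where
  /-- the possible states (RAM contents) of a vertex -/
  State : Type
  /-- there are finitely many states -/
  finite_state : Finite State
  /-- the initial state of a vertex, given its ID -/
  init : Fin N → State
  /-- the new state, given the ID, the present state and the set of states of the neighbors -/
  next : Fin N → State → Set State → State
  /-- the output of a vertex in a given state -/
  output : State → Out

namespace VertexAlgorithm

variable {n : ℕ} {Out : Type}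

/-- The new state of the virtual vertex that corresponds to an edge with endpoints `a < b`, when
the registers of `a` and `b` contain `ra` and `rb`. The ID of the virtual vertex is `a * n + b`.
Its present state is the one held by `a`, the endpoint with the smaller ID (the state held by `b`,
or else the initial state, is used only if `a` does not have a register for this edge yet). Its
neighbors in the line graph are the other virtual vertices at `a` and at `b`. -/
noncomputable def edgeNext (A : VertexAlgorithm (n * n) Out) (a b : Fin n)
    (ra rb : Fin n → Option A.State) : A.State :=
  A.next (finProdFinEquiv (a, b))
    (((ra b).or (rb a)).getD (A.init (finProdFinEquiv (a, b))))
    ({s | ∃ u, u ≠ b ∧ ra u = some s} ∪ {s | ∃ u, u ≠ a ∧ rb u = some s})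

/-- The simulation of `A` on the line graph of the network. The RAM of a vertex `v` consists of one
register for each edge at `v`; it holds a copy of the state of the virtual vertex that corresponds
to this edge. The register for the edge to `u` contains `some s` if this state is `s`, and it
contains `none` if `v` simulates no virtual vertex for `u`. -/
noncomputable def lineGraphSimulation (A : VertexAlgorithm (n * n) Out) :
    LocalAlgorithm n Out where
  RAM := Fin n → Option A.State
  step v r B := fun u =>
    match B u with
    | none => none
    | some r' => some (if v < u then A.edgeNext v u r r' else A.edgeNext u v r' r)
  edgeOutput r u := (r u).map A.output

end VertexAlgorithm

/-! One coloring of the line graph serves both problems: properly color it with `0, …, D`, where `D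
= 2 * Δ - 2`, so that every vertex of nonzero color sees the color `0`. The coloring is a proper
edge coloring with `D + 1 = 2 * Δ - 1` colors (for `Δ ≥ 1`), and the class of color `0` is a maximal
matching.

Such a coloring comes from three stages, each correct from arbitrary states on any proper input
coloring. Color reduction by polynomials over finite fields leaves `O(1 + D ^ 4)` colors after
`O(log* n)` rounds. A clocked rotation through candidates (`solves_proper_zmod`) leaves `q = O(D +
1)` colors in `q + 1` rounds, and a greedy recoloring along the order of these colors takes `q`
more. The stages run at the same time, each reading the current output of the one before. A stage
has its correct input once its predecessor has settled, and the garbage it has computed until then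
is just another arbitrary initial state (`Solves.comp`). Rounds add up and state counts multiply.

In the network, one faultless round makes the two copies at each edge agree, empties all registers
without an edge and restores the ID stored in each virtual state. From then on the simulation is a
run of the rule on the line graph, from uncontrolled states. -/

/-- `x` is an execution on the graph `G` of the rule `next`, in which the vertices have the input
`c`, and every vertex sees its own input and state and the set of those of its neighbors. -/
def IsRun {V α S : Type} (G : SimpleGraph V) (next : α → S → Set (α × S) → S) (c : V → α)
    (x : ℕ → V → S) : Prop :=
  ∀ t v, x (t + 1) v = next (c v) (x t v) ((fun u => (c u, x t u)) '' G.neighborSet v)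

/-- Adjacent vertices have different colors. -/
def ProperColoring (β : Type) ⦃V : Type⦄ (G : SimpleGraph V) (c : V → β) : Prop :=
  ∀ u v, G.Adj u v → c u ≠ c v

/-- A proper coloring with the colors `0, …, D` in which every vertex whose color is not `0` has a
neighbor of color `0`. -/
def GreedyColoring (D : ℕ) ⦃V : Type⦄ (G : SimpleGraph V) (c : V → ℕ) : Prop :=
  ProperColoring ℕ G c ∧ (∀ v, c v ≤ D) ∧ ∀ v, c v ≠ 0 → ∃ u, G.Adj v u ∧ c u = 0

/-- There is a rule with at most `s` states which on graphs of maximum degree at most `D` with any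
proper coloring with colors in `α` as the input computes a solution of `P` within `T` rounds,
starting from arbitrary states. -/
def Solves (D T s : ℕ) (α : Type) {β : Type}
    (P : ∀ ⦃V : Type⦄, SimpleGraph V → (V → β) → Prop) : Prop :=
  ∃ (S : Type) (_ : Finite S) (_ : Nonempty S) (next : α → S → Set (α × S) → S)
    (out : α → S → β), Nat.card S ≤ s ∧
    ∀ (V : Type) [Finite V] (G : SimpleGraph V), (∀ v, (G.neighborSet v).ncard ≤ D) →
      ∀ c : V → α, ProperColoring α G c → ∀ x : ℕ → V → S, IsRun G next c x →
        ∃ f : V → β, P G f ∧ ∀ t, T ≤ t → ∀ v, out (c v) (x t v) = f v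

/-! ### Composition of self-stabilizing stages -/

section Solves

variable {D T T' s s' : ℕ} {α β γ : Type}

theorem Solves.mono {P : ∀ ⦃V : Type⦄, SimpleGraph V → (V → β) → Prop}
    (h : Solves D T s α P) (hT : T ≤ T') (hs : s ≤ s') : Solves D T' s' α P := by
  obtain ⟨S, h1, h2, next, out, hS, h⟩ := h
  refine ⟨S, h1, h2, next, out, hS.trans hs, fun V _ G hG c hc x hx => ?_⟩
  obtain ⟨f, hf, hfx⟩ := h V G hG c hc x hx
  exact ⟨f, hf, fun t ht => hfx t (hT.trans ht)⟩

theorem Solves.refl (D : ℕ) (α : Type) : Solves D 0 1 α (ProperColoring α) :=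
  ⟨Unit, inferInstance, inferInstance, fun _ _ _ => (), fun a _ => a, by simp,
    fun _ _ _ _ c hc _ _ => ⟨c, hc, fun _ _ _ => rfl⟩⟩

theorem Solves.comp {P : ∀ ⦃V : Type⦄, SimpleGraph V → (V → γ) → Prop}
    (h₁ : Solves D T s α (ProperColoring β)) (h₂ : Solves D T' s' β P) :
    Solves D (T + T') (s * s') α P := by
  obtain ⟨S₁, _, _, next₁, out₁, hS₁, h₁⟩ := h₁
  obtain ⟨S₂, _, _, next₂, out₂, hS₂, h₂⟩ := h₂
  refine ⟨S₁ × S₂, inferInstance, inferInstance,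
    fun a s M => (next₁ a s.1 ((fun p => (p.1, p.2.1)) '' M),
      next₂ (out₁ a s.1) s.2 ((fun p => (out₁ p.1 p.2.1, p.2.2)) '' M)),
    fun a s => out₂ (out₁ a s.1) s.2, ?_, fun V _ G hG c hc x hx => ?_⟩
  · rw [Nat.card_prod]
    exact Nat.mul_le_mul hS₁ hS₂
  obtain ⟨f, hf, hfx⟩ := h₁ V G hG c hc (fun t v => (x t v).1) (fun t v => by
    simp only [hx t v, Set.image_image])
  -- The second component is viewed from round `T` on. Its state there is uncontrolled, which
  -- `Solves` allows, and its input is the constant coloring `f`.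
  obtain ⟨g, hg, hgx⟩ := h₂ V G hG f hf (fun t v => (x (T + t) v).2) (fun t v => by
    have h := hx (T + t) v
    change (x (T + t + 1) v).2 = _
    rw [h]
    simp only [Set.image_image]
    simp only [hfx (T + t) (Nat.le_add_right _ _)])
  refine ⟨g, hg, fun t ht v => ?_⟩
  obtain ⟨t', rfl⟩ := Nat.exists_eq_add_of_le (show T ≤ t by omega)
  simp only [hfx (T + t') (by omega)]
  exact hgx t' (by omega) v

end Solves

/-! ### One round of color reduction by polynomials -/

section Polynomials

open Polynomial

theorem exists_injective_polynomial_degree_lt {α : Type} [Finite α] {r d : ℕ} [Fact r.Prime]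
    (h : Nat.card α ≤ r ^ d) :
    ∃ f : α → (ZMod r)[X], Function.Injective f ∧ ∀ a, (f a).degree < d := by
  have := Fintype.ofFinite α
  have hc : Fintype.card α ≤ Fintype.card (Fin d → ZMod r) := by
    rw [← Nat.card_eq_fintype_card]
    simpa [ZMod.card] using h
  obtain ⟨e⟩ := Function.Embedding.nonempty_of_card_le hc
  refine ⟨fun a => ((degreeLTEquiv (ZMod r) d).symm (e a) : (ZMod r)[X]), fun a b hab => ?_,
    fun a => mem_degreeLT.1 ((degreeLTEquiv (ZMod r) d).symm (e a)).2⟩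
  exact e.injective ((degreeLTEquiv (ZMod r) d).symm.injective (Subtype.ext hab))

theorem ncard_eval_eq_zero_le {F : Type} [Field F] {p : F[X]} {d : ℕ} (hp : p ≠ 0)
    (hd : p.natDegree ≤ d) : {x | p.eval x = 0}.ncard ≤ d := by
  classical
  have : {x | p.eval x = 0} = (p.roots.toFinset : Set F) := by
    ext x
    simp [hp, IsRoot.def]
  rw [this, Set.ncard_coe_finset]
  exact (Multiset.toFinset_card_le _).trans ((card_roots' p).trans hd)

/-- Among more than `D * d` elements there is one that lies in none of at most `D` sets with at
most `d` elements. -/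
theorem exists_notMem_of_ncard_le {ι F : Type} [Finite F] {D d : ℕ} {I : Set ι} (hI : I.Finite)
    (hD : I.ncard ≤ D) {B : ι → Set F} (hB : ∀ i ∈ I, (B i).ncard ≤ d) (h : D * d < Nat.card F) :
    ∃ x, ∀ i ∈ I, x ∉ B i := by
  by_contra! hcon
  have hle : (⋃ i ∈ hI.toFinset, B i).ncard ≤ D * d := by
    refine (Finset.set_ncard_biUnion_le _ _).trans ?_
    refine (Finset.sum_le_card_nsmul _ _ d fun i hi => hB i (by simpa using hi)).trans ?_
    rw [smul_eq_mul, ← Set.ncard_eq_toFinset_card I hI]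
    exact Nat.mul_le_mul_right d hD
  have huniv : (⋃ i ∈ hI.toFinset, B i) = Set.univ := by
    ext x
    simpa using hcon x
  rw [huniv, Set.ncard_univ] at hle
  omega

open Classical in
/-- One round of color reduction by polynomials over a finite field. -/
theorem solves_proper_of_card_le_pow {α : Type} [Finite α] {D d r : ℕ} (hr : r.Prime)
    (hD : D * d < r) (h : Nat.card α ≤ r ^ d) :
    Solves D 1 (r ^ 2) α (ProperColoring (ZMod r × ZMod r)) := by
  have : Fact r.Prime := ⟨hr⟩
  obtain ⟨f, hf, hdeg⟩ := exists_injective_polynomial_degree_lt h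
  -- Distinct polynomials of degree below `d` agree in at most `d` points, and `D * d < r`, so some
  -- point separates a vertex from all its neighbors; the default `0` is never used. The new color
  -- is this point with the value there: neighbors with the same point have different values. Old
  -- states are ignored, so corruption is harmless.
  let g : α → Set α → ZMod r := fun a M =>
    if h : ∃ x, ∀ b ∈ M, b ≠ a → (f b).eval x ≠ (f a).eval x then h.choose else 0
  refine ⟨ZMod r × ZMod r, inferInstance, inferInstance,
    fun a _ M => (g a (Prod.fst '' M), (f a).eval (g a (Prod.fst '' M))), fun _ s => s, ?_,
    fun V _ G hG c hc x hx => ?_⟩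
  · simp [pow_two]
  have key : ∀ v u, G.Adj v u → (f (c u)).eval (g (c v) (c '' G.neighborSet v)) ≠
      (f (c v)).eval (g (c v) (c '' G.neighborSet v)) := by
    intro v u hvu
    have hex : ∃ x, ∀ b ∈ c '' G.neighborSet v, b ≠ c v →
        (f b).eval x ≠ (f (c v)).eval x := by
      obtain ⟨x, hx⟩ := exists_notMem_of_ncard_le (F := ZMod r) (Set.toFinite (G.neighborSet v))
        (hG v) (B := fun u => {x | (f (c u) - f (c v)).eval x = 0}) (d := d) (fun u hu =>
          ncard_eval_eq_zero_le (sub_ne_zero.2 fun hcc => hc v u hu (hf hcc).symm)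
            (natDegree_le_of_degree_le ((degree_sub_le _ _).trans
              (max_le (hdeg _).le (hdeg _).le)))) (by simpa using hD)
      refine ⟨x, ?_⟩
      rintro _ ⟨w, hw, rfl⟩ - hcon
      exact hx w hw (by simp [hcon])
    have hg : g (c v) (c '' G.neighborSet v) = hex.choose := dif_pos hex
    rw [hg]
    exact hex.choose_spec _ ⟨u, hvu, rfl⟩ (hc v u hvu).symm
  refine ⟨fun v => (g (c v) (c '' G.neighborSet v), (f (c v)).eval (g (c v) (c '' G.neighborSet v))),
    fun u v huv heq => ?_, fun t ht v => ?_⟩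
  · have h1 := congrArg Prod.fst heq
    have h2 := congrArg Prod.snd heq
    simp only at h1 h2
    rw [h1] at h2
    exact key v u huv.symm h2
  · obtain ⟨t, rfl⟩ := Nat.exists_eq_add_of_le' ht
    simp only [hx t v, Set.image_image]

end Polynomials

/-! ### Iterated color reduction and `logStar` -/

section Chain

/-- The induction step works because `(13 / 12) ^ 8 < 2`. The bound keeps the product of the state
counts along the chain of reductions under control. -/
theorem twenty_mul_pow_le_two_pow {L : ℕ} (hL : 105 ≤ L) : 20 * L ^ 8 ≤ 2 ^ (L - 1) := by
  induction L, hL using Nat.le_induction with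
  | base => norm_num
  | succ L hL ih =>
    have h1 : (12 * (L + 1)) ^ 8 ≤ (13 * L) ^ 8 := Nat.pow_le_pow_left (by omega) 8
    have h2 : 2 ^ (L + 1 - 1) = 2 * 2 ^ (L - 1) := by
      rw [← pow_succ']
      congr 1
      omega
    rw [mul_pow, mul_pow] at h1
    norm_num only at h1
    omega

/-- `O(log* n)` rounds of color reduction. -/
theorem exists_solves_proper_of_iterate_logb_lt (D k : ℕ) :
    ∀ (y : ℝ) (α : Type) [Finite α], 0 ≤ y → (Real.logb 2)^[k] y < 2 →
      (Nat.card α : ℝ) ≤ (y + 1) ^ 8 →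
      ∃ (β : Type) (_ : Finite β), Nat.card β ≤ 2 ^ 104 + 4 * D ^ 4 ∧
        Solves D (k + 1) ((Nat.card α + 1) * (4 * D ^ 4 + 1)) α (ProperColoring β) := by
  have small : ∀ (k : ℕ) (α : Type) [Finite α], Nat.card α ≤ 2 ^ 104 →
      ∃ (β : Type) (_ : Finite β), Nat.card β ≤ 2 ^ 104 + 4 * D ^ 4 ∧
        Solves D (k + 1) ((Nat.card α + 1) * (4 * D ^ 4 + 1)) α (ProperColoring β) :=
    fun k α _ h => ⟨α, inferInstance, by omega,
      (Solves.refl D α).mono (by omega) (Nat.mul_pos (by omega) (by omega))⟩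
  induction k with
  | zero =>
    intro y α _ hy hk hcard
    refine small _ α ?_
    have h1 : (y + 1) ^ 8 ≤ 3 ^ 8 :=
      pow_le_pow_left₀ (by linarith) (by simp at hk; linarith) 8
    have h2 : (Nat.card α : ℝ) ≤ (2 ^ 104 : ℕ) := by
      push_cast
      refine (hcard.trans h1).trans (by norm_num)
    exact_mod_cast h2
  | succ k ih =>
    intro y α _ hy hk hcard
    rcases le_or_gt (Nat.card α) (2 ^ 104) with hm | hm
    · exact small _ α hm
    set m := Nat.card α with hmdef
    obtain ⟨L, hL⟩ : ∃ L, L = Nat.log 2 m + 1 := ⟨_, rfl⟩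
    have hm0 : m ≠ 0 := by omega
    have hlt : m < 2 ^ L := hL ▸ Nat.lt_pow_succ_log_self (by norm_num) m
    have hge : 2 ^ (L - 1) ≤ m := by
      rw [hL]
      exact Nat.pow_log_le_self 2 hm0
    have hL105 : 105 ≤ L := by
      have := (Nat.pow_lt_pow_iff_right (a := 2) (by norm_num)).1 (hm.trans hlt)
      omega
    -- The color count is below `2 ^ L`, so polynomials of degree below `L` suffice over any prime
    -- field. If `L ≤ D`, a prime of order `D ^ 2` finishes in one round. Otherwise a prime of order
    -- `L ^ 2` is used and the induction goes on with `Real.logb 2 y`.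
    rcases le_or_gt L D with hLD | hLD
    · obtain ⟨r, hr, hr1, hr2⟩ := Nat.exists_prime_lt_and_le_two_mul (D * D)
        (by have : 0 < D := by omega
            positivity)
      have hrr : r ^ 2 ≤ 4 * D ^ 4 := (Nat.pow_le_pow_left hr2 2).trans (le_of_eq (by ring))
      have : NeZero r := ⟨hr.ne_zero⟩
      refine ⟨ZMod r × ZMod r, inferInstance, ?_,
        (solves_proper_of_card_le_pow (d := L) hr ?_ ?_).mono (by omega) ?_⟩
      · simp only [Nat.card_prod, Nat.card_zmod]
        rw [← pow_two]
        omega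
      · exact (Nat.mul_le_mul_left D hLD).trans_lt hr1
      · exact hlt.le.trans (Nat.pow_le_pow_left hr.two_le L)
      · calc r ^ 2 ≤ 1 * (4 * D ^ 4 + 1) := by omega
          _ ≤ _ := Nat.mul_le_mul_right _ (by omega)
    · obtain ⟨r, hr, hr1, hr2⟩ := Nat.exists_prime_lt_and_le_two_mul (L * L)
        (by have : 0 < L := by omega
            positivity)
      have hrr : r ^ 2 ≤ 4 * L ^ 4 := (Nat.pow_le_pow_left hr2 2).trans (le_of_eq (by ring))
      have : NeZero r := ⟨hr.ne_zero⟩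
      have hcardr : Nat.card (ZMod r × ZMod r) = r ^ 2 := by
        simp only [Nat.card_prod, Nat.card_zmod, pow_two]
      have hstep := solves_proper_of_card_le_pow (α := α) (D := D) (d := L) hr
        ((Nat.mul_le_mul_right L hLD.le).trans_lt hr1)
        (hlt.le.trans (Nat.pow_le_pow_left hr.two_le L))
      -- The threshold `2 ^ 104 = (2 ^ 13) ^ 8` makes `Real.logb 2 y + 1` at least `13`, and `4 * 9
      -- ^ 4 ≤ 13 ^ 4` then restores the invariant with exponent `8`.
      have hy13 : (2 : ℝ) ^ 13 < y + 1 := by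
        refine lt_of_pow_lt_pow_left₀ 8 (by linarith) ?_
        calc ((2 : ℝ) ^ 13) ^ 8 = ((2 ^ 104 : ℕ) : ℝ) := by norm_num
          _ < m := by exact_mod_cast hm
          _ ≤ _ := hcard
      have hy1 : 2 ^ 12 ≤ y := by linarith
      have hz : 12 ≤ Real.logb 2 y := by
        rw [Real.le_logb_iff_rpow_le (by norm_num) (by linarith)]
        exact_mod_cast hy1
      have hLz : (L : ℝ) ≤ 9 * (Real.logb 2 y + 1) := by
        have h1 : ((L - 1 : ℕ) : ℝ) ≤ Real.logb 2 m := by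
          rw [Real.le_logb_iff_rpow_le (by norm_num) (by positivity), Real.rpow_natCast]
          exact_mod_cast hge
        have h2 : Real.logb 2 m ≤ 8 * (Real.logb 2 y + 1) := by
          calc Real.logb 2 m ≤ Real.logb 2 ((y * 2) ^ 8) := by
                refine Real.logb_le_logb_of_le (by norm_num) (by positivity) (hcard.trans ?_)
                exact pow_le_pow_left₀ (by linarith) (by linarith) 8
            _ = 8 * (Real.logb 2 y + 1) := by
                rw [Real.logb_pow, Real.logb_mul (by linarith) (by norm_num),
                  Real.logb_self_eq_one (by norm_num)]
                norm_num
        rw [Nat.cast_sub (by omega)] at h1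
        push_cast at h1
        linarith
      obtain ⟨β, hβ, hβc, hsolve⟩ := ih (Real.logb 2 y) (ZMod r × ZMod r) (by linarith)
        (by simpa [Function.iterate_succ_apply] using hk) (by
          rw [hcardr]
          calc ((r ^ 2 : ℕ) : ℝ) ≤ ((4 * L ^ 4 : ℕ) : ℝ) := by exact_mod_cast hrr
            _ = 4 * (L : ℝ) ^ 4 := by push_cast; ring
            _ ≤ 4 * (9 * (Real.logb 2 y + 1)) ^ 4 := by gcongr
            _ = (4 * 9 ^ 4) * (Real.logb 2 y + 1) ^ 4 := by ring
            _ ≤ (Real.logb 2 y + 1) ^ 4 * (Real.logb 2 y + 1) ^ 4 := by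
                gcongr
                calc (4 * 9 ^ 4 : ℝ) ≤ 13 ^ 4 := by norm_num
                  _ ≤ _ := pow_le_pow_left₀ (by norm_num) (by linarith) 4
            _ = _ := by ring)
      -- The state bound telescopes because `r ^ 2 * (r ^ 2 + 1)` is at most `m + 1`.
      refine ⟨β, hβ, hβc, (hstep.comp hsolve).mono (by omega) ?_⟩
      rw [hcardr, ← mul_assoc]
      refine Nat.mul_le_mul_right _ ?_
      have h20 := twenty_mul_pow_le_two_pow hL105
      have hL4 : L ^ 4 ≤ L ^ 8 := Nat.pow_le_pow_right (by omega) (by norm_num)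
      calc r ^ 2 * (r ^ 2 + 1) ≤ 4 * L ^ 4 * (4 * L ^ 4 + 1) := Nat.mul_le_mul hrr (by omega)
        _ = 16 * L ^ 8 + 4 * L ^ 4 := by ring
        _ ≤ m + 1 := by omega

/-- For `x ≥ 2` a logarithm lowers the number by at least `1`, as `log₂ x ≤ x - 1`. Hence the
infimum defining `logStar` is attained. -/
theorem exists_iterate_logb_lt_two (x : ℝ) : ∃ k, (Real.logb 2)^[k] x < 2 := by
  obtain ⟨n, hn⟩ := exists_nat_gt x
  induction n generalizing x with
  | zero => exact ⟨0, by simp at hn ⊢; linarith⟩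
  | succ n ih =>
    rcases lt_or_ge x 2 with h | h
    · exact ⟨0, h⟩
    have h1 : Real.logb 2 x ≤ x - 1 := by
      rw [Real.logb_le_iff_le_rpow (by norm_num) (by linarith)]
      have := one_add_mul_self_le_rpow_one_add (s := 1) (by norm_num) (p := x - 1) (by linarith)
      norm_num at this
      exact this
    obtain ⟨k, hk⟩ := ih (Real.logb 2 x) (by push_cast at hn; linarith)
    exact ⟨k + 1, hk⟩

theorem iterate_logb_logStar_lt_two (n : ℕ) : (Real.logb 2)^[logStar n] (n : ℝ) < 2 :=
  Nat.sInf_mem (exists_iterate_logb_lt_two n)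

end Chain

/-! ### Rotating candidates with unsynchronized clocks -/

section Rotation

open Polynomial

/-- The shift `s` is the unknown offset of two clocks. The coefficient of `X ^ 5` is `6 * s` on the
left and `0` on the right, so the leading term `X ^ 6` rules out every nonzero offset; for `s = 0`
the polynomials `f` and `g` differ. -/
theorem X_pow_six_add_comp_ne {q : ℕ} [Fact q.Prime] (hq : 6 < q) {f g : (ZMod q)[X]}
    (hf : f.degree < (5 : ℕ)) (hg : g.degree < (5 : ℕ)) (hfg : f ≠ g) (s : ZMod q) :
    (X ^ 6 + f).comp (X + C s) ≠ X ^ 6 + g := by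
  intro h
  by_cases hs : s = 0
  · simp [hs] at h
    exact hfg h
  have h5 := congrArg (fun p => coeff p 5) h
  have hf5 : (f.comp (X + C s)).coeff 5 = 0 := by
    refine coeff_eq_zero_of_natDegree_lt ?_
    rw [natDegree_comp, natDegree_X_add_C, mul_one]
    rcases eq_or_ne f 0 with rfl | h0
    · simp
    · exact (natDegree_lt_iff_degree_lt h0).2 hf
  have hg5 : g.coeff 5 = 0 := (degree_lt_iff_coeff_zero _ _).1 hg 5 le_rfl
  simp only [add_comp, X_pow_comp, coeff_add, hf5, hg5, coeff_X_add_C_pow, coeff_X_pow] at h5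
  norm_num at h5
  rcases h5 with h5 | h5
  · exact hs h5
  · have h6 : ((6 : ℕ) : ZMod q) = 0 := by
      rw [← h5]
      norm_num [Nat.choose]
    rw [ZMod.natCast_eq_zero_iff] at h6
    exact absurd (Nat.le_of_dvd (by norm_num) h6) (by omega)

theorem ncard_eval_comp_eq_le {q : ℕ} [Fact q.Prime] (hq : 6 < q) {f g : (ZMod q)[X]}
    (hf : f.degree < (5 : ℕ)) (hg : g.degree < (5 : ℕ)) (hfg : f ≠ g) (s : ZMod q) :
    {y | (X ^ 6 + f).eval (y + s) = (X ^ 6 + g).eval y}.ncard ≤ 6 := by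
  have h := ncard_eval_eq_zero_le (sub_ne_zero.2 (X_pow_six_add_comp_ne hq hf hg hfg s)) (d := 6)
    (by
      have h6 : ∀ p : (ZMod q)[X], p.degree < (5 : ℕ) → (X ^ 6 + p).natDegree ≤ 6 := fun p hp =>
        natDegree_le_of_degree_le ((degree_add_le _ _).trans
          (max_le (degree_X_pow_le 6) (hp.le.trans (by norm_num))))
      refine (natDegree_sub_le _ _).trans (max_le ?_ (h6 g hg))
      rw [natDegree_comp, natDegree_X_add_C, mul_one]
      exact h6 f hf)
  convert h using 3
  ext y
  rw [eval_sub, eval_comp, sub_eq_zero]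
  simp only [eval_add, eval_X, eval_C]

theorem ncard_eval_X_pow_six_add_eq_le {q : ℕ} [Fact q.Prime] {g : (ZMod q)[X]}
    (hg : g.degree < (5 : ℕ)) (z : ZMod q) : {y | z = (X ^ 6 + g).eval y}.ncard ≤ 6 := by
  have hlt : (g - C z).degree < ((6 : ℕ) : WithBot ℕ) :=
    (degree_sub_le _ _).trans_lt (max_lt (hg.trans (by norm_num))
      (degree_C_le.trans_lt (by norm_num)))
  have h := ncard_eval_eq_zero_le (monic_X_pow_add hlt).ne_zero (d := 6)
    (natDegree_le_of_degree_le ((degree_add_le _ _).trans (max_le (degree_X_pow_le 6) hlt.le)))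
  convert h using 3
  ext y
  rw [← add_sub_assoc, eval_sub, eval_C, sub_eq_zero, eq_comm]

open Classical in
/-- Every vertex has a clock and rotates through candidate colors. It keeps the first candidate
that is neither a present candidate nor the permanent color of a neighbor. -/
theorem solves_proper_zmod {α : Type} [Finite α] {D q : ℕ} (hq : q.Prime) (h6 : 6 < q)
    (hD : D * 12 < q) (h : Nat.card α ≤ q ^ 5) :
    Solves D (q + 1) (q * (q + 1)) α (ProperColoring (ZMod q)) := by
  have : Fact q.Prime := ⟨hq⟩
  obtain ⟨f, hf, hdeg⟩ := exists_injective_polynomial_degree_lt h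
  obtain ⟨cand, hcand⟩ : ∃ cand : α → ZMod q → ZMod q, cand = fun a y => (X ^ 6 + f a).eval y :=
    ⟨_, rfl⟩
  let next : α → ZMod q × Option (ZMod q) → Set (α × ZMod q × Option (ZMod q)) →
      ZMod q × Option (ZMod q) := fun a s M =>
    (s.1 + 1, match s.2 with
      | some z => if ∃ p ∈ M, p.2.2 = some z then none else some z
      | none => if ∃ p ∈ M, p.2.2 = some (cand a s.1) ∨ cand p.1 p.2.1 = cand a s.1 then none
          else some (cand a s.1))
  refine ⟨ZMod q × Option (ZMod q), inferInstance, inferInstance, next,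
    fun _ s => s.2.getD 0, ?_, fun V _ G hG c hc x hx => ?_⟩
  · rw [Nat.card_prod, Finite.card_option, Nat.card_zmod]
  have hclock : ∀ t v, (x t v).1 = (x 0 v).1 + t := by
    intro t v
    induction t with
    | zero => simp
    | succ t ih =>
      rw [hx t v]
      simp only [next, ih]
      push_cast
      ring
  have hsome : ∀ t v z, (x t v).2 = some z → (∀ u, G.Adj v u → (x t u).2 ≠ some z) →
      (x (t + 1) v).2 = some z := by
    intro t v z hz hu
    rw [hx t v]
    simp only [next, hz]
    rw [if_neg]
    rintro ⟨_, ⟨u, huv, rfl⟩, hp⟩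
    exact hu u huv hp
  have hnone : ∀ t v, (x t v).2 = none →
      (∀ u, G.Adj v u → (x t u).2 ≠ some (cand (c v) (x t v).1) ∧
        cand (c u) (x t u).1 ≠ cand (c v) (x t v).1) →
      (x (t + 1) v).2 = some (cand (c v) (x t v).1) := by
    intro t v hz hu
    rw [hx t v]
    simp only [next, hz]
    rw [if_neg]
    rintro ⟨_, ⟨u, huv, rfl⟩, hp⟩
    exact hp.elim (hu u huv).1 (hu u huv).2
  have hpre : ∀ t v z, (x (t + 1) v).2 = some z → (∀ u, G.Adj v u → (x t u).2 ≠ some z) ∧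
      ((x t v).2 = some z ∨
        cand (c v) (x t v).1 = z ∧ ∀ u, G.Adj v u → cand (c u) (x t u).1 ≠ z) := by
    intro t v z hz
    rw [hx t v] at hz
    simp only [next] at hz
    split at hz
    · rename_i w hw
      split_ifs at hz with hex
      rw [Option.some_inj] at hz
      subst hz
      exact ⟨fun u huv hu => hex ⟨_, ⟨u, huv, rfl⟩, hu⟩, Or.inl hw⟩
    · split_ifs at hz with hex
      rw [Option.some_inj] at hz
      subst hz
      exact ⟨fun u huv hu => hex ⟨_, ⟨u, huv, rfl⟩, Or.inl hu⟩,
        Or.inr ⟨rfl, fun u huv hu => hex ⟨_, ⟨u, huv, rfl⟩, Or.inr hu⟩⟩⟩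
  -- After any round, neighbors hold different colors: a color survives or is adopted only if no
  -- neighbor held it, and neighbors with equal candidates do not adopt. So from round `1` on a held
  -- color is permanent.
  have hinv : ∀ t u v z, G.Adj u v → (x (t + 1) u).2 = some z → (x (t + 1) v).2 ≠ some z := by
    intro t u v z huv hu hv
    obtain ⟨hu1, hu2⟩ := hpre t u z hu
    obtain ⟨hv1, hv2⟩ := hpre t v z hv
    rcases hu2 with hu2 | ⟨hu2, hu3⟩
    · exact hv1 u huv.symm hu2
    · rcases hv2 with hv2 | ⟨hv2, hv3⟩
      · exact hu1 v huv hv2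
      · exact hu3 v huv hv2
  have hstay : ∀ v z t, 1 ≤ t → (x t v).2 = some z → ∀ t', t ≤ t' → (x t' v).2 = some z := by
    intro v z t ht hz t' htt'
    induction t', htt' using Nat.le_induction with
    | base => exact hz
    | succ t' htt' ih =>
      obtain ⟨t'', rfl⟩ := Nat.exists_eq_add_of_le' (ht.trans htt')
      exact hsome _ v z ih fun u huv => hinv t'' v u z huv ih
  have hdone : ∀ v, (x (q + 1) v).2 ≠ none := by
    intro v hv
    have hnever : ∀ t, 1 ≤ t → t ≤ q + 1 → (x t v).2 = none := by
      intro t ht htq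
      by_contra hcon
      obtain ⟨z, hz⟩ := Option.ne_none_iff_exists'.1 hcon
      rw [hstay v z t ht hz _ htq] at hv
      cases hv
    -- Each neighbor spoils at most `6` clock values by its candidates and `6` by its permanent
    -- color, and `12 * D < q`. Any color held at a round from `1` to `q` is still held at round
    -- `q`; for a neighbor without one, the default `0` only excludes more values.
    obtain ⟨y, hy⟩ := exists_notMem_of_ncard_le (F := ZMod q) (Set.toFinite (G.neighborSet v))
      (hG v) (B := fun u =>
        {y | (X ^ 6 + f (c u)).eval (y + ((x 0 u).1 - (x 0 v).1)) = (X ^ 6 + f (c v)).eval y} ∪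
        {y | (x q u).2.getD 0 = (X ^ 6 + f (c v)).eval y}) (d := 12) (fun u hu =>
          (Set.ncard_union_le _ _).trans (add_le_add
            (ncard_eval_comp_eq_le h6 (hdeg _) (hdeg _)
              (fun hcc => hc v u hu (hf hcc).symm) _)
            (ncard_eval_X_pow_six_add_eq_le (hdeg _) _))) (by simpa using hD)
    -- This is the round among `1, …, q` in which the clock of `v` shows `y`; round `0` is avoided
    -- since colors held then need not last.
    obtain ⟨t, htdef⟩ : ∃ t, t = (y - (x 0 v).1 - 1).val + 1 := ⟨_, rfl⟩
    have ht1 : 1 ≤ t := by omega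
    have htq : t ≤ q := by
      have := ZMod.val_lt (y - (x 0 v).1 - 1)
      omega
    have hty : (x t v).1 = y := by
      rw [hclock, htdef]
      push_cast
      rw [ZMod.natCast_val, ZMod.cast_id]
      ring
    have hend := hnone t v (hnever t ht1 (by omega)) fun u huv => by
      have hyu := hy u huv
      simp only [Set.mem_union, Set.mem_ofPred_eq, not_or] at hyu
      rw [hty]
      refine ⟨fun hz => hyu.2 ?_, fun hz => hyu.1 ?_⟩
      · rw [hstay u _ t ht1 hz q htq, Option.getD_some, hcand]
      · simp only [hclock t u, hcand] at hz
        rw [← hz, ← hty, hclock t v]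
        congr 1
        ring
    rw [hnever (t + 1) (by omega) (by omega)] at hend
    cases hend
  choose g hg using fun v => Option.ne_none_iff_exists'.1 (hdone v)
  refine ⟨g, fun u v huv huv' => ?_, fun t ht v => ?_⟩
  · exact hinv q u v (g u) huv (hg u) (huv' ▸ hg v)
  · simp only [hstay v _ _ (by omega) (hg v) t ht, Option.getD_some]

end Rotation

/-! ### Greedy recoloring along a color order -/

section Greedy

open Classical in
/-- The color `0` if it is not in `A`, and otherwise some color at most `D` that is not in `A`, if
there is one. -/
noncomputable def freeColor {D : ℕ} (A : Set (Fin (D + 1))) : Fin (D + 1) :=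
  if h : 0 ∈ A ∧ ∃ z, z ∉ A then h.2.choose else 0

theorem freeColor_notMem {D : ℕ} {A : Set (Fin (D + 1))} (hA : A.ncard ≤ D) : freeColor A ∉ A := by
  have hex : ∃ z, z ∉ A := by
    by_contra! hcon
    rw [Set.eq_univ_of_forall hcon, Set.ncard_univ, Nat.card_eq_fintype_card,
      Fintype.card_fin] at hA
    omega
  unfold freeColor
  split_ifs with h
  · exact h.2.choose_spec
  · exact fun h0 => h ⟨h0, hex⟩

theorem zero_mem_of_freeColor_ne_zero {D : ℕ} {A : Set (Fin (D + 1))} (h : freeColor A ≠ 0) :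
    0 ∈ A := by
  by_contra h0
  exact h (dif_neg fun h' => h0 h'.1)

/-- Every vertex looks only at neighbors of smaller input color, so vertices settle in the order of
their input colors, one class per round. Preferring the color `0` gives every other vertex a
neighbor of color `0`. -/
theorem solves_greedyColoring {α : Type} [Finite α] (D : ℕ) :
    Solves D (Nat.card α) (D + 1) α (GreedyColoring D) := by
  let e := Finite.equivFin α
  refine ⟨Fin (D + 1), inferInstance, inferInstance,
    fun a _ M => freeColor {z | ∃ p ∈ M, e p.1 < e a ∧ p.2 = z}, fun _ s => s, by simp,
    fun V _ G hG c hc x hx => ?_⟩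
  have hx' : ∀ t v, x (t + 1) v =
      freeColor {z | ∃ u, G.Adj v u ∧ e (c u) < e (c v) ∧ x t u = z} := by
    intro t v
    rw [hx t v]
    refine congrArg freeColor (Set.ext fun z => ?_)
    constructor
    · rintro ⟨_, ⟨u, hu, rfl⟩, h1, h2⟩
      exact ⟨u, hu, h1, h2⟩
    · rintro ⟨u, hu, h1, h2⟩
      exact ⟨_, ⟨u, hu, rfl⟩, h1, h2⟩
  have hstable : ∀ k v, (e (c v) : ℕ) < k → ∀ t, k ≤ t → x t v = x k v := by
    intro k
    induction k with
    | zero => intro v hv; omega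
    | succ k ih =>
      intro v hv t ht
      obtain ⟨t, rfl⟩ := Nat.exists_eq_add_of_le' (show 1 ≤ t by omega)
      rw [hx', hx']
      congr 1
      ext z
      refine exists_congr fun u => and_congr_right fun _ => and_congr_right fun hlt => ?_
      rw [ih u (by have := Fin.lt_def.1 hlt; omega) t (by omega)]
  have hfix : ∀ t, Nat.card α ≤ t → ∀ v, x t v = x (Nat.card α) v :=
    fun t ht v => hstable _ v (e (c v)).2 t ht
  have hgreedy : ∀ v, x (Nat.card α) v =
      freeColor {z | ∃ u, G.Adj v u ∧ e (c u) < e (c v) ∧ x (Nat.card α) u = z} := by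
    intro v
    rw [← hfix (Nat.card α + 1) (by omega) v, hx']
  have hcard : ∀ v, {z | ∃ u, G.Adj v u ∧ e (c u) < e (c v) ∧ x (Nat.card α) u = z}.ncard ≤ D := by
    intro v
    refine le_trans (Set.ncard_le_ncard ?_ ((Set.toFinite (G.neighborSet v)).image _))
      ((Set.ncard_image_le (Set.toFinite (G.neighborSet v)) (f := x (Nat.card α))).trans (hG v))
    rintro _ ⟨u, hu, -, rfl⟩
    exact ⟨u, hu, rfl⟩
  have hne : ∀ u v, G.Adj u v → e (c u) < e (c v) → x (Nat.card α) u ≠ x (Nat.card α) v := by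
    intro u v huv hlt heq
    have h := freeColor_notMem (hcard v)
    rw [← hgreedy v] at h
    exact h ⟨u, huv.symm, hlt, heq⟩
  refine ⟨fun v => x (Nat.card α) v, ⟨fun u v huv heq => ?_, fun v => Fin.is_le _,
    fun v hv => ?_⟩,
    fun t ht v => by simp only [hfix t ht v]⟩
  · rcases lt_or_gt_of_ne (fun h => hc u v huv (e.injective h)) with hlt | hlt
    · exact hne u v huv hlt (Fin.ext heq)
    · exact hne v u huv.symm hlt (Fin.ext heq.symm)
  · have h0 : x (Nat.card α) v ≠ 0 := fun h => hv (congrArg Fin.val h)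
    rw [hgreedy v] at h0
    obtain ⟨u, hu, -, h⟩ := zero_mem_of_freeColor_ne_zero h0
    exact ⟨u, hu, congrArg Fin.val h⟩

end Greedy

/-- Greedy coloring of graphs with vertex IDs, in linear-in-`Δ`-plus-`log*` time with
polynomially many states. -/
theorem exists_solves_greedyColoring : ∃ C : ℕ, ∀ N D : ℕ,
    Solves D (C * (D + 1 + logStar (Nat.sqrt N))) ((N + D + 2) ^ C) (Fin N) (GreedyColoring D) := by
  obtain ⟨K, hK⟩ : ∃ K, K = 2 ^ 104 := ⟨_, rfl⟩
  refine ⟨50 * K + 100, fun N D => ?_⟩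
  -- Starting from `Nat.sqrt N` is possible thanks to the exponent `8` in the invariant; for `N = n
  -- * n` it gives `logStar n` itself.
  obtain ⟨β, _, hβ, hchain⟩ := exists_solves_proper_of_iterate_logb_lt D (logStar (Nat.sqrt N))
    (Nat.sqrt N) (Fin N) (by positivity) (iterate_logb_logStar_lt_two _) (by
      have h1 : N ≤ (Nat.sqrt N + 1) ^ 8 := by
        calc N ≤ (Nat.sqrt N + 1) ^ 2 := by
              rw [pow_two]
              exact (Nat.lt_succ_sqrt N).le
          _ ≤ _ := Nat.pow_le_pow_right (by omega) (by norm_num)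
      rw [Nat.card_eq_fintype_card, Fintype.card_fin]
      exact_mod_cast h1)
  rw [← hK] at hβ
  have hK1 : 6 ≤ K := by rw [hK]; norm_num
  -- Bertrand's postulate gives `q = O(D + 1)`, large enough for the rotation (`12 * D < q`) and for
  -- `K + 4 * D ^ 4 ≤ q ^ 5`.
  obtain ⟨q, hq, hq1, hq2⟩ := Nat.exists_prime_lt_and_le_two_mul (12 * D + K + 4) (by omega)
  have : NeZero q := ⟨hq.ne_zero⟩
  have hβq : Nat.card β ≤ q ^ 5 := by
    calc Nat.card β ≤ K + 4 * D ^ 4 := hβ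
      _ ≤ q * q ^ 4 := by
        have h1 : D ^ 4 ≤ q ^ 4 := Nat.pow_le_pow_left (by omega) 4
        have h2 : 1 ≤ q ^ 4 := Nat.one_le_pow _ _ hq.pos
        obtain ⟨j, rfl⟩ := Nat.exists_eq_add_of_le (show K + 4 ≤ q by omega)
        nlinarith
      _ = q ^ 5 := by ring
  refine ((hchain.comp (solves_proper_zmod hq (by omega) (by omega) hβq)).comp
    (solves_greedyColoring D)).mono ?_ ?_
  · rw [Nat.card_zmod]
    nlinarith
  · obtain ⟨B, hB⟩ : ∃ B, B = N + D + 2 := ⟨_, rfl⟩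
    have hB2 : 2 ≤ B := by omega
    have h1 : Nat.card (Fin N) + 1 ≤ B := by
      rw [Nat.card_eq_fintype_card, Fintype.card_fin]
      omega
    have h2 : 4 * D ^ 4 + 1 ≤ B ^ 6 := by
      have h3 : D ^ 4 + 1 ≤ B ^ 4 :=
        Nat.succ_le_of_lt (Nat.pow_lt_pow_left (by omega) (by norm_num))
      calc 4 * D ^ 4 + 1 ≤ 2 ^ 2 * B ^ 4 := by omega
        _ ≤ B ^ 2 * B ^ 4 := Nat.mul_le_mul_right _ (Nat.pow_le_pow_left hB2 2)
        _ = B ^ 6 := by ring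
    -- As `B` may be as small as `2`, the constant `K` is moved into the exponent through `K < 2 ^ K
    -- ≤ B ^ K`.
    have h3 : q + 1 ≤ B ^ (K + 6) := by
      have hK2 : K < 2 ^ K := Nat.lt_two_pow_self
      have hKB : 2 ^ K ≤ B ^ K := Nat.pow_le_pow_left hB2 K
      calc q + 1 ≤ 24 * B + 2 * K + 9 := by omega
        _ ≤ 2 ^ 5 * K * B := by nlinarith
        _ ≤ B ^ 5 * B ^ K * B := by
          refine Nat.mul_le_mul_right _ (Nat.mul_le_mul (Nat.pow_le_pow_left hB2 5) (by omega))
        _ = B ^ (K + 6) := by ring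
    rw [← hB]
    calc (Nat.card (Fin N) + 1) * (4 * D ^ 4 + 1) * (q * (q + 1)) * (D + 1)
        ≤ B * B ^ 6 * (B ^ (K + 6) * B ^ (K + 6)) * B := by
          gcongr
          · omega
          · omega
      _ = B ^ (2 * K + 20) := by ring
      _ ≤ B ^ (50 * K + 100) := Nat.pow_le_pow_right (by omega) (by omega)

/-! ### Degrees and IDs in the line graph -/

section LineGraph

/-- The line graph of the graph with the set of edges `E`. -/
def edgeLineGraph {V : Type} (E : Set (Sym2 V)) : SimpleGraph E where
  Adj e e' := e ≠ e' ∧ Incident e.1 e'.1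
  symm := ⟨fun _ _ h => ⟨h.1.symm, h.2.imp fun _ hv => hv.symm⟩⟩
  loopless := ⟨fun _ h => h.1 rfl⟩

theorem Network.DegreeAtMost.ncard_neighborSet_edgeLineGraph_le {n Δ : ℕ} {G : Network n}
    (hG : G.DegreeAtMost Δ) (e : G.edgeSet) :
    ((edgeLineGraph G.edgeSet).neighborSet e).ncard ≤ 2 * Δ - 2 := by
  obtain ⟨e, he⟩ := e
  induction e using Sym2.ind with
  | _ a b =>
  have hab : G.Adj a b := he
  have hN : ∀ u w : Fin n, G.Adj u w →
      ((fun z => s(u, z)) '' (G.neighborSet u \ {w})).ncard ≤ Δ - 1 := fun u w h => by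
    refine (Set.ncard_image_le (Set.toFinite _)).trans ?_
    rw [Set.ncard_sdiff_singleton_of_mem (show w ∈ G.neighborSet u from h)]
    exact Nat.sub_le_sub_right (hG u) 1
  have hsub : Subtype.val '' ((edgeLineGraph G.edgeSet).neighborSet ⟨s(a, b), he⟩) ⊆
      (fun z => s(a, z)) '' (G.neighborSet a \ {b}) ∪
        (fun z => s(b, z)) '' (G.neighborSet b \ {a}) := by
    rintro _ ⟨⟨e', he'⟩, ⟨hne, v, hv, hv'⟩, rfl⟩
    obtain ⟨w, rfl⟩ := Sym2.mem_iff_exists.1 hv'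
    have hvw : G.Adj v w := he'
    rcases Sym2.mem_iff.1 hv with rfl | rfl
    · exact Or.inl ⟨w, ⟨hvw, fun h => hne (by rw [Set.mem_singleton_iff] at h; subst h; rfl)⟩, rfl⟩
    · refine Or.inr ⟨w, ⟨hvw, fun h => hne ?_⟩, rfl⟩
      rw [Set.mem_singleton_iff] at h
      subst h
      exact Subtype.ext Sym2.eq_swap
  rw [← Set.ncard_image_of_injective _ Subtype.val_injective]
  refine (Set.ncard_le_ncard hsub (Set.toFinite _)).trans ((Set.ncard_union_le _ _).trans ?_)
  have := hN a b hab
  have := hN b a hab.symm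
  omega

/-- The ID of the virtual vertex for the edge `e`. -/
def edgeID {n : ℕ} (e : Sym2 (Fin n)) : Fin (n * n) :=
  finProdFinEquiv (e.inf, e.sup)

theorem edgeID_mk {n : ℕ} {a b : Fin n} (h : a < b) : edgeID s(a, b) = finProdFinEquiv (a, b) := by
  simp [edgeID, h.le]

theorem edgeID_injective {n : ℕ} : Function.Injective (edgeID (n := n)) := by
  intro e e' h
  have h' := Prod.ext_iff.1 (finProdFinEquiv.injective h)
  exact Sym2.inf_eq_inf_and_sup_eq_sup.1 h'

end LineGraph

/-! ### The simulation as a run on the line graph -/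

namespace VertexAlgorithm

/-- The vertex algorithm in which every vertex keeps its ID in its state and otherwise follows a
rule that uses the IDs as the input. -/
noncomputable def ofRule {N : ℕ} {S Out : Type} (hS : Finite S) (hne : Nonempty S)
    (next : Fin N → S → Set (Fin N × S) → S) (out : Fin N → S → Out) : VertexAlgorithm N Out where
  State := Fin N × S
  finite_state := inferInstance
  init i := (i, Classical.arbitrary S)
  next i s M := (i, next i s.2 M)
  output s := out s.1 s.2

section Simulation

variable {n : ℕ} {Out : Type}

theorem lineGraphSimulation_register (A : VertexAlgorithm (n * n) Out) {G : ℕ → Network n}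
    {σ : ℕ → Fin n → A.lineGraphSimulation.RAM} {t₀ t : ℕ}
    (h : A.lineGraphSimulation.FaultFreeFrom G σ t₀) (ht : t₀ ≤ t) {a b : Fin n}
    (hab : (G t₀).Adj a b) (hlt : a < b) :
    σ (t + 1) a b = some (A.edgeNext a b (σ t a) (σ t b)) ∧
      σ (t + 1) b a = some (A.edgeNext a b (σ t a) (σ t b)) := by
  constructor
  · rw [(h t ht).2 a hab.fst_mem]
    simp only [LocalAlgorithm.nextRAM, lineGraphSimulation, if_pos hab, if_pos hlt]
  · rw [(h t ht).2 b hab.snd_mem]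
    simp only [LocalAlgorithm.nextRAM, lineGraphSimulation, if_pos hab.symm, if_neg hlt.not_gt]

theorem lineGraphSimulation_register_eq_none (A : VertexAlgorithm (n * n) Out)
    {G : ℕ → Network n} {σ : ℕ → Fin n → A.lineGraphSimulation.RAM} {t₀ t : ℕ}
    (h : A.lineGraphSimulation.FaultFreeFrom G σ t₀) (ht : t₀ ≤ t) {a b : Fin n}
    (ha : a ∈ (G t₀).verts) (hab : ¬ (G t₀).Adj a b) : σ (t + 1) a b = none := by
  rw [(h t ht).2 a ha]
  simp only [LocalAlgorithm.nextRAM, lineGraphSimulation, if_neg hab]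

variable {S : Type}

/-- After one round, the simulation is an execution of the rule on the line graph. -/
theorem exists_isRun_of_faultFreeFrom (hS : Finite S) (hne : Nonempty S)
    (next : Fin (n * n) → S → Set (Fin (n * n) × S) → S) (out : Fin (n * n) → S → Out)
    {G : ℕ → Network n} {σ : ℕ → Fin n → (ofRule hS hne next out).lineGraphSimulation.RAM}
    {t₀ : ℕ} (h : (ofRule hS hne next out).lineGraphSimulation.FaultFreeFrom G σ t₀) :
    ∃ x : ℕ → (G t₀).edgeSet → S,
      IsRun (edgeLineGraph (G t₀).edgeSet) next (fun e => edgeID e.1) x ∧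
      ∀ t u v, (huv : (G t₀).Adj u v) →
        σ (t₀ + 1 + t) u v = some (edgeID s(u, v), x t ⟨s(u, v), huv⟩) := by
  let r : ℕ → Fin n → Fin n → Option (Fin (n * n) × S) := fun t => σ (t₀ + 1 + t)
  obtain ⟨x, hx⟩ : ∃ x : ℕ → (G t₀).edgeSet → S, x = fun t e =>
      ((r t e.1.inf e.1.sup).map Prod.snd).getD (Classical.arbitrary S) := ⟨_, rfl⟩
  have hlt : ∀ t a b, (hab : (G t₀).Adj a b) → a < b →
      r t a b = some (edgeID s(a, b), x t ⟨s(a, b), hab⟩) ∧ r t b a = r t a b := by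
    intro t a b hab hlt
    obtain ⟨h1, h2⟩ := lineGraphSimulation_register (ofRule hS hne next out) h
      (Nat.le_add_right t₀ t) hab hlt
    rw [show t₀ + t + 1 = t₀ + 1 + t by omega] at h1 h2
    refine ⟨?_, h2.trans h1.symm⟩
    have h1' : r t a b = some _ := h1
    rw [hx]
    simp only [Sym2.inf_mk, Sym2.sup_mk, inf_eq_left.2 hlt.le, sup_eq_right.2 hlt.le, h1',
      edgeID_mk hlt]
    rfl
  have hreg : ∀ t u v, (huv : (G t₀).Adj u v) →
      r t u v = some (edgeID s(u, v), x t ⟨s(u, v), huv⟩) := by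
    intro t u v huv
    rcases lt_or_gt_of_ne huv.ne with hl | hl
    · exact (hlt t u v huv hl).1
    · rw [(hlt t v u huv.symm hl).2, (hlt t v u huv.symm hl).1]
      simp only [Sym2.eq_swap (a := v) (b := u)]
  have hnone : ∀ t u v, u ∈ (G t₀).verts → ¬ (G t₀).Adj u v → r t u v = none := by
    intro t u v hu huv
    have h1 := lineGraphSimulation_register_eq_none (ofRule hS hne next out) h
      (Nat.le_add_right t₀ t) hu huv
    rw [show t₀ + t + 1 = t₀ + 1 + t by omega] at h1
    exact h1
  have hiff : ∀ t u v s, u ∈ (G t₀).verts → (r t u v = some s ↔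
      ∃ huv : (G t₀).Adj u v, (edgeID s(u, v), x t ⟨s(u, v), huv⟩) = s) := by
    intro t u v s hu
    by_cases huv : (G t₀).Adj u v
    · rw [hreg t u v huv, Option.some_inj]
      exact ⟨fun h => ⟨huv, h⟩, fun ⟨_, h⟩ => h⟩
    · rw [hnone t u v hu huv]
      exact ⟨fun h => (by cases h), fun ⟨h, _⟩ => absurd h huv⟩
  refine ⟨x, ?_, hreg⟩
  rintro t ⟨e, he⟩
  obtain ⟨a, b, hl, rfl⟩ : ∃ a b, a < b ∧ e = s(a, b) := by
    induction e using Sym2.ind with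
    | _ a b =>
      have hab : (G t₀).Adj a b := he
      rcases lt_or_gt_of_ne hab.ne with hl | hl
      · exact ⟨a, b, hl, rfl⟩
      · exact ⟨b, a, hl, Sym2.eq_swap⟩
  have hab : (G t₀).Adj a b := he
  have h1 : r (t + 1) a b = some ((ofRule hS hne next out).edgeNext a b (r t a) (r t b)) :=
    (lineGraphSimulation_register (ofRule hS hne next out) h
      (show t₀ ≤ t₀ + 1 + t by omega) hab hl).1
  have h2 : x (t + 1) ⟨s(a, b), he⟩ =
      ((ofRule hS hne next out).edgeNext a b (r t a) (r t b)).2 := by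
    have h3 := (hreg (t + 1) a b hab).symm.trans h1
    exact congrArg Prod.snd (Option.some_inj.1 h3)
  -- Registers without an edge are empty by now, so the states read at `a` and `b` are exactly those
  -- of the line graph neighbors, with correct IDs.
  have hM : ({s | ∃ u, u ≠ b ∧ r t a u = some s} ∪ {s | ∃ u, u ≠ a ∧ r t b u = some s}) =
      (fun e : (G t₀).edgeSet => (edgeID e.1, x t e)) ''
        (edgeLineGraph (G t₀).edgeSet).neighborSet ⟨s(a, b), he⟩ := by
    ext s
    constructor
    · rintro (⟨u, hu, hs⟩ | ⟨u, hu, hs⟩)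
      · obtain ⟨hau, rfl⟩ := (hiff t a u s hab.fst_mem).1 hs
        refine ⟨⟨s(a, u), hau⟩, ⟨fun heq => hu ?_, a, by simp, by simp⟩, rfl⟩
        exact (Sym2.congr_right.1 (congrArg Subtype.val heq)).symm
      · obtain ⟨hbu, rfl⟩ := (hiff t b u s hab.snd_mem).1 hs
        refine ⟨⟨s(b, u), hbu⟩, ⟨fun heq => hu ?_, b, by simp, by simp⟩, rfl⟩
        exact (Sym2.congr_right.1 (Sym2.eq_swap.trans (congrArg Subtype.val heq))).symm
    · rintro ⟨⟨e', he'⟩, ⟨hne', v, hv, hv'⟩, rfl⟩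
      obtain ⟨w, rfl⟩ := Sym2.mem_iff_exists.1 hv'
      have hvw : (G t₀).Adj v w := he'
      rcases Sym2.mem_iff.1 hv with rfl | rfl
      · exact Or.inl ⟨w, fun hw => hne' (by subst hw; rfl), hreg t v w hvw⟩
      · exact Or.inr ⟨w, fun hw => hne' (by subst hw; exact Subtype.ext Sym2.eq_swap),
          hreg t v w hvw⟩
  rw [h2]
  simp only [edgeNext, ofRule]
  rw [← hM, hreg t a b hab, ← edgeID_mk hl]
  rfl

/-- A rule that finds greedy colorings gives rise to a self-stabilizing algorithm for edge
problems which a greedy coloring of the line graph solves. -/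
theorem stabilizesWithin_of_greedyColoring {Δ T : ℕ} (hS : Finite S) (hne : Nonempty S)
    (next : Fin (n * n) → S → Set (Fin (n * n) × S) → S) (out : Fin (n * n) → S → ℕ)
    (hsolves : ∀ (V : Type) [Finite V] (G : SimpleGraph V),
      (∀ v, (G.neighborSet v).ncard ≤ 2 * Δ - 2) → ∀ c : V → Fin (n * n),
      ProperColoring _ G c → ∀ x : ℕ → V → S, IsRun G next c x →
        ∃ f : V → ℕ, GreedyColoring (2 * Δ - 2) G f ∧ ∀ t, T ≤ t → ∀ v, out (c v) (x t v) = f v)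
    (g : ℕ → Out) {Spec : Set (Sym2 (Fin n)) → (Sym2 (Fin n) → Out) → Prop}
    (hSpec : ∀ (E : Set (Sym2 (Fin n))) (f : Sym2 (Fin n) → ℕ),
      GreedyColoring (2 * Δ - 2) (edgeLineGraph E) (fun e => f e.1) → Spec E (fun e => g (f e))) :
    (ofRule hS hne next fun i s => g (out i s)).lineGraphSimulation.StabilizesWithin Δ (1 + T)
      Spec := by
  classical
  intro G σ t₀ hG h
  obtain ⟨x, hx, hxσ⟩ := exists_isRun_of_faultFreeFrom hS hne next _ h
  obtain ⟨f, hf, hfx⟩ := hsolves _ _ hG.ncard_neighborSet_edgeLineGraph_le _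
    (fun e e' hee' heq => hee'.1 (Subtype.ext (edgeID_injective heq))) x hx
  let F : Sym2 (Fin n) → ℕ := fun e => if he : e ∈ (G t₀).edgeSet then f ⟨e, he⟩ else 0
  have hF : (fun e : (G t₀).edgeSet => F e.1) = f := funext fun e => dif_pos e.2
  refine ⟨fun e => g (F e), hSpec _ F (hF ▸ hf), fun t ht u v huv => ?_⟩
  obtain ⟨t, rfl⟩ := Nat.exists_eq_add_of_le (show t₀ + 1 ≤ t by omega)
  change Option.map _ (σ (t₀ + 1 + t) u v) = _
  rw [hxσ t u v huv]
  have hout := hfx t (by omega) ⟨s(u, v), huv⟩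
  have hFe : F s(u, v) = f ⟨s(u, v), huv⟩ := dif_pos huv
  change some (g (out (edgeID s(u, v)) (x t ⟨s(u, v), huv⟩))) = some (g (F s(u, v)))
  rw [hFe, ← hout]

end Simulation

end VertexAlgorithm

theorem LocalAlgorithm.StabilizesWithin.mono {n Δ T T' : ℕ} {Out : Type}
    {A : LocalAlgorithm n Out} {Spec : Set (Sym2 (Fin n)) → (Sym2 (Fin n) → Out) → Prop}
    (h : A.StabilizesWithin Δ T Spec) (hT : T ≤ T') : A.StabilizesWithin Δ T' Spec := by
  intro G σ t₀ hG hA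
  obtain ⟨f, hf, hfx⟩ := h G σ t₀ hG hA
  exact ⟨f, hf, fun t ht => hfx t (by omega)⟩

/-- For `Δ = 0` there are no edges. The case is separate because `Δ + logStar n` may be `0`, leaving
no room for the initial round of the simulation. -/
theorem LocalAlgorithm.stabilizesWithin_zero {n : ℕ} {Out : Type} (A : LocalAlgorithm n Out)
    (T : ℕ) {Spec : Set (Sym2 (Fin n)) → (Sym2 (Fin n) → Out) → Prop}
    {f : Sym2 (Fin n) → Out} (hf : Spec ∅ f) : A.StabilizesWithin 0 T Spec := by
  intro G σ t₀ hG _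
  have hadj : ∀ u v, ¬ (G t₀).Adj u v := by
    intro u v huv
    have h0 := (Set.ncard_eq_zero (Set.toFinite _)).1 (Nat.le_zero.1 (hG u))
    exact Set.notMem_empty v (h0 ▸ (show v ∈ (G t₀).neighborSet u from huv))
  have hE : (G t₀).edgeSet = ∅ := by
    ext e
    induction e using Sym2.ind with
    | _ a b => simpa using hadj a b
  exact ⟨f, hE ▸ hf, fun t _ u v huv => absurd huv (hadj u v)⟩

/-! ### From greedy colorings to matchings and edge colorings -/

theorem GreedyColoring.isMaximalMatching {n D : ℕ} {E : Set (Sym2 (Fin n))}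
    {f : Sym2 (Fin n) → ℕ} (h : GreedyColoring D (edgeLineGraph E) (fun e => f e.1)) :
    IsMaximalMatching E {e | e ∈ E ∧ decide (f e = 0) = true} := by
  obtain ⟨h1, -, h3⟩ := h
  refine ⟨fun e he => he.1, ?_, fun e he heM => ?_⟩
  · rintro e ⟨he, hfe⟩ e' ⟨he', hfe'⟩ hne hinc
    rw [decide_eq_true_iff] at hfe hfe'
    exact h1 ⟨e, he⟩ ⟨e', he'⟩ ⟨fun h => hne (congrArg Subtype.val h), hinc⟩ (hfe.trans hfe'.symm)
  · obtain ⟨u, hu, hfu⟩ := h3 ⟨e, he⟩ fun h0 => heM ⟨he, decide_eq_true h0⟩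
    exact ⟨u.1, ⟨u.2, decide_eq_true hfu⟩, hu.2⟩

theorem GreedyColoring.isProperEdgeColoring {n D : ℕ} {E : Set (Sym2 (Fin n))}
    {f : Sym2 (Fin n) → ℕ} (h : GreedyColoring D (edgeLineGraph E) (fun e => f e.1)) :
    IsProperEdgeColoring E (D + 1) f :=
  ⟨fun e he => Nat.lt_succ_of_le (h.2.1 ⟨e, he⟩), fun e he e' he' hne hinc =>
    h.1 ⟨e, he⟩ ⟨e', he'⟩ ⟨fun h => hne (congrArg Subtype.val h), hinc⟩⟩

theorem mainTheorem6 :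
    ∃ (C : ℕ) (mis : ∀ N D : ℕ, VertexAlgorithm N Bool) (col : ∀ N D : ℕ, VertexAlgorithm N ℕ),
      (∀ N D : ℕ,
        Nat.card (mis N D).State ≤ (N + D + 2) ^ C ∧
        Nat.card (col N D).State ≤ (N + D + 2) ^ C) ∧
      ∀ n Δ : ℕ,
        (mis (n * n) (2 * Δ - 2)).lineGraphSimulation.StabilizesWithin Δ
          (C * (Δ + logStar n))
          (fun E f => IsMaximalMatching E {e | e ∈ E ∧ f e = true}) ∧
        (col (n * n) (2 * Δ - 2)).lineGraphSimulation.StabilizesWithin Δ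
          (C * (Δ + logStar n))
          (fun E f => IsProperEdgeColoring E (2 * Δ - 1) f) := by
  obtain ⟨C, hC⟩ := exists_solves_greedyColoring
  choose S hS hne next out hcard hsolves using hC
  have hstates : ∀ N D, Nat.card (Fin N × S N D) ≤ (N + D + 2) ^ (2 * C + 1) := by
    intro N D
    rw [Nat.card_prod, Nat.card_eq_fintype_card, Fintype.card_fin]
    calc N * Nat.card (S N D) ≤ (N + D + 2) * (N + D + 2) ^ C :=
          Nat.mul_le_mul (by omega) (hcard N D)
      _ = (N + D + 2) ^ (C + 1) := by ring
      _ ≤ _ := Nat.pow_le_pow_right (by omega) (by omega)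
  refine ⟨2 * C + 1,
    fun N D => .ofRule (hS N D) (hne N D) (next N D) fun i s => decide (out N D i s = 0),
    fun N D => .ofRule (hS N D) (hne N D) (next N D) (out N D),
    fun N D => ⟨hstates N D, hstates N D⟩, fun n Δ => ?_⟩
  rcases Nat.eq_zero_or_pos Δ with rfl | hΔ
  · exact ⟨LocalAlgorithm.stabilizesWithin_zero _ _ (f := fun _ => false)
        (by simp [IsMaximalMatching]),
      LocalAlgorithm.stabilizesWithin_zero _ _ (f := fun _ => 0)
        (by simp [IsProperEdgeColoring])⟩
  -- The leading `1` is the round in which the copies are reconciled; it is absorbed since `Δ ≥ 1`.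
  have hT : 1 + C * (2 * Δ - 2 + 1 + logStar (Nat.sqrt (n * n))) ≤
      (2 * C + 1) * (Δ + logStar n) := by
    rw [Nat.sqrt_eq]
    have h1 : 2 * Δ - 2 + 1 + logStar n ≤ 2 * (Δ + logStar n) := by omega
    calc 1 + C * (2 * Δ - 2 + 1 + logStar n) ≤ (Δ + logStar n) + C * (2 * (Δ + logStar n)) :=
          Nat.add_le_add (by omega) (Nat.mul_le_mul_left C h1)
      _ = (2 * C + 1) * (Δ + logStar n) := by ring
  constructor
  · exact (VertexAlgorithm.stabilizesWithin_of_greedyColoring _ _ _ _ (hsolves _ _)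
      (fun k => decide (k = 0)) fun E f h => h.isMaximalMatching).mono hT
  · refine (VertexAlgorithm.stabilizesWithin_of_greedyColoring _ _ _ _ (hsolves _ _)
      (fun k => k) fun E f h => ?_).mono hT
    rw [show 2 * Δ - 1 = 2 * Δ - 2 + 1 by omega]
    exact h.isProperEdgeColoring
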